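/- **Networks and codes.** A *network* is a finite, directed, acyclic multigraph together with finitely many *messages*, each generated at a node (a *source*), and for each node a set of messages which it *demands* (a node with demands is a *receiver*). The *inputs* of a node are the messages generated at it and its incoming edges. Let $k,n\ge 1$ and let $\mathbb F$ be a finite field. A *$(k,n)$ linear code over $\mathbb F$* assigns to each edge an edge function, and to each demand of each receiver a decoding function, each of the form $$(x_1,\dots,x_i,y_1,\dots,y_j)\mapsto M_1x_1+\dots+M_ix_i+M_1'y_1+\dots+M_j'y_j ,$$ where $x_1,\dots,x_i\in\mathbb F^k$ are the values of the messages generated at the node in question (for an edge, its starting node), $y_1,\dots,y_j\in\mathbb F^n$ are the vectors carried by its incoming edges, and the $M$'s and $M'$'s are constant matrices over $\mathbb F$; edge functions take values in $\mathbb F^n$ and decoding functions in $\mathbb F^k$. It is a *$(k,n)$ linear solution* if, for all values of the messages, each decoding function returns the demanded message. A network is *asymptotically linear solvable over $\mathbb F$* if for every $\epsilon>0$ it has a $(k,n)$ linear solution over $\mathbb F$ for some $k,n\ge 1$ with $k/n>1-\epsilon$. **Blocks.** For $s\ge 2$ the block $B(s)$ has message inputs $y_0,\dots,y_s$, each generated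 by its own source, and nodes $u_i,v_i,R_i$ ($0\le i\le s$), $u$, $v$. There is an edge from the source of $y_j$ to $u_i$ for all $j\ne i$, and an edge from the source of $y_j$ to $u$ for every $j$. There are edges $u_i\to v_i$, $u\to v$, $v_i\to R_i$, $v\to R_i$. The receiver $R_i$ demands $y_i$. The $i$-th output edge of $B(s)$ is a further edge out of $v_i$; it is used only where this is stated. * $\mathcal N_1(m)$, $m\ge2$: one block $B(m)$ with inputs $x_0,\dots,x_m$, and an additional receiver which receives all of the output edges and demands $x_0$. * $\mathcal N_2(m,w)$, $m\ge 2$, $w\ge 1$: $w$ blocks $B(m+1)$. The $0$-th input of every block is one shared message $z$; the inputs $1,\dots,m+1$ of each block are messages of its own. An additional receiver receives all of the output edges of all blocks except the $0$-th output edge of each block, and demands $z$. * $\mathcal N_3(m_1,m_2)$, $m_1,m_2\ge 2$: a block $B(m_1)$ and a block $B(m_2)$. The $0$-th input of both blocks is one shared message $z$; the other inputs of each block are messages of its own. An additional receiver receives all of the output edges of both blocks and demands $z$. **The network $\mathcal N_4(m)$.** Let $m\ge 2$ have prime factorization $m=p_1^{\gamma_1}\cdots p_\omega^{\gamma_\omega}$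 with distinct primes $p_i$ and $\gamma_i\ge 1$. Put $$f(m)=\prod_{i=1}^{\omega}p_i^{\gamma_i-1},\qquad \mu(m,i)=\min\{\alpha\ge 0: p_i^\alpha\ge f(m)\},\qquad g(m,i)=p_i^{\gamma_i-1}\prod_{j\ne i}p_j^{\mu(m,j)} ,$$ and let $\mathcal N_4(m)$ be the disjoint union of networks $$\mathcal N_4(m)=\Bigl(\bigcup_{\substack{q\text{ prime}\\ q\nmid m,\ q<f(m)}}\mathcal N_1(q)\Bigr)\cup\Bigl(\bigcup_{i=1}^{\omega}\mathcal N_2\bigl(p_i^{\gamma_i},\,m/p_i^{\gamma_i}\bigr)\Bigr)\cup\Bigl(\bigcup_{\substack{1\le i\le\omega\\ \gamma_i>1}}\mathcal N_3\bigl(p_i,\,g(m,i)\bigr)\Bigr).$$ **Corollary.** For every composite integer $m$ and every finite field $\mathbb F$, the network $\mathcal N_4(m)$ is not asymptotically linear solvable over $\mathbb F$. -/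

import Mathlib

/-! ## Networks -/

/-- A network: a finite, directed, acyclic multigraph with node type `V` and edge type `E`
(the edge `e` goes from `src e` to `tgt e`), together with finitely many messages `M`.
The message `x` is generated at the node `origin x`, and `demands v` is the set of messages which
the node `v` wishes to obtain.  A source is a node at which some message is generated, a receiver
is a node with a non-empty set of demands. -/
structure Network where
  V : Type
  E : Type
  M : Type
  fintypeV : Fintype V
  fintypeE : Fintype E
  fintypeM : Fintype M
  src : E → V
  tgt : E → V
  origin : M → V
  demands : V → Set M
  /-- There is no directed cycle. -/
  acyclic : ∀ v : V, ¬ Relation.TransGen (fun a b => ∃ e, src e = a ∧ tgt e = b) v v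

attribute [instance] Network.fintypeV Network.fintypeE Network.fintypeM

namespace Network

/-- The messages originating at the node `v`. -/
abbrev MsgAt (N : Network) (v : N.V) : Type := {x : N.M // N.origin x = v}

/-- The incoming edges of the node `v`. -/
abbrev InEdge (N : Network) (v : N.V) : Type := {d : N.E // N.tgt d = v}

/-- A function of the inputs of the node `v`: it maps a `k`-dimensional vector for every message
originating at `v` and an `n`-dimensional vector for every incoming edge of `v` to an
`r`-dimensional vector over the alphabet `A`. -/
abbrev NodeFn (N : Network) (A : Type*) (k n : ℕ) (v : N.V) (r : ℕ) : Type _ :=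
  (N.MsgAt v → Fin k → A) → (N.InEdge v → Fin n → A) → (Fin r → A)

/-- A `(k, n)` fractional code over the alphabet `A`: an edge function for every edge, and a
decoding function for every demand of every receiver. -/
structure Code (N : Network) (A : Type*) (k n : ℕ) where
  edgeFn : (e : N.E) → N.NodeFn A k n (N.src e) n
  decodeFn : (v : N.V) → (x : N.M) → x ∈ N.demands v → N.NodeFn A k n v k

open scoped Classical in
/-- A function of the inputs of `v` is linear over `F` if it has the form
`M₁ x₁ + ⋯ + Mᵢ xᵢ + M'₁ y₁ + ⋯ + M'ⱼ yⱼ` for constant matrices over `F`. -/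
def NodeFn.IsLinear {N : Network} {F : Type*} [Field F] {k n : ℕ} {v : N.V} {r : ℕ}
    (f : N.NodeFn F k n v r) : Prop :=
  ∃ (P : N.MsgAt v → Matrix (Fin r) (Fin k) F) (Q : N.InEdge v → Matrix (Fin r) (Fin n) F),
    ∀ (a : N.MsgAt v → Fin k → F) (b : N.InEdge v → Fin n → F),
      f a b = ∑ i, (P i).mulVec (a i) + ∑ j, (Q j).mulVec (b j)

namespace Code

variable {N : Network} {A : Type*} {k n : ℕ}

/-- If the messages take the values `x`, then the edges carry the vectors `y` given by the edge
functions of the code. -/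
def Carries (C : N.Code A k n) (x : N.M → Fin k → A) (y : N.E → Fin n → A) : Prop :=
  ∀ e : N.E, y e = C.edgeFn e (fun i => x i.1) (fun j => y j.1)

/-- As the network is acyclic, the messages determine the vectors carried by the edges. -/
theorem existsUnique_carries (C : N.Code A k n) (x : N.M → Fin k → A) :
    ∃! y : N.E → Fin n → A, C.Carries x y := by
  let T : N.E → N.E → Prop := Relation.TransGen (fun d e => N.tgt d = N.src e)
  have key : ∀ d e : N.E, T d e →
      Relation.TransGen (fun a b => ∃ e, N.src e = a ∧ N.tgt e = b) (N.src d) (N.src e) := by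
    intro d e h
    induction h with
    | single h => exact .single ⟨d, rfl, h⟩
    | tail _ h ih => exact ih.tail ⟨_, rfl, h⟩
  have hirr : Std.Irrefl T := ⟨fun e h => N.acyclic _ (key e e h)⟩
  have htr : IsTrans N.E T := ⟨fun _ _ _ h h' => h.trans h'⟩
  have hwf : WellFounded T := Finite.wellFounded_of_trans_of_irrefl T
  let y : N.E → Fin n → A := hwf.fix fun e ih =>
    C.edgeFn e (fun i => x i.1) (fun j => ih j.1 (.single j.2))
  refine ⟨y, fun e => hwf.fix_eq _ e, fun y' hy' => funext fun e => ?_⟩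
  induction e using hwf.induction with
  | _ e ih =>
    have hye : y e = C.edgeFn e (fun i => x i.1) (fun j => y j.1) := hwf.fix_eq _ e
    rw [hy' e, hye]
    congr 1
    funext j
    exact ih j.1 (.single j.2)

/-- A code is a solution if, for all values `x` of the messages, every receiver recovers all
components of each of its demands from its inputs; here `y` are the vectors carried by the
edges. -/
def IsSolution (C : N.Code A k n) : Prop :=
  ∀ x : N.M → Fin k → A, ∃ y : N.E → Fin n → A, C.Carries x y ∧
    ∀ (v : N.V) (m : N.M) (h : m ∈ N.demands v),
      C.decodeFn v m h (fun i => x i.1) (fun j => y j.1) = x m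

/-- A code is linear if every edge function and every decoding function is linear. -/
def IsLinear {F : Type*} [Field F] (C : N.Code F k n) : Prop :=
  (∀ e, NodeFn.IsLinear (C.edgeFn e)) ∧ ∀ v m h, NodeFn.IsLinear (C.decodeFn v m h)

end Code

/-- There is a `(k, n)` linear solution for `N` over `F`. -/
def HasLinearSolution (N : Network) (F : Type*) [Field F] (k n : ℕ) : Prop :=
  ∃ C : N.Code F k n, C.IsLinear ∧ C.IsSolution

/-- `N` is asymptotically linear solvable over `F`: for every `ε > 0` there is a `(k, n)` linear
solution over `F` for some `k` and `n` with `k / n > 1 - ε`. -/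
def AsymptoticallyLinearSolvable (N : Network) (F : Type*) [Field F] : Prop :=
  ∀ ε : ℝ, 0 < ε → ∃ k n : ℕ, 0 < k ∧ 0 < n ∧ (k : ℝ) / n > 1 - ε ∧ N.HasLinearSolution F k n

/-- The disjoint union of a finite family of networks. -/
def disjointUnion {ι : Type} [Fintype ι] (N : ι → Network) : Network where
  V := Σ i, (N i).V
  E := Σ i, (N i).E
  M := Σ i, (N i).M
  fintypeV := inferInstance
  fintypeE := inferInstance
  fintypeM := inferInstance
  src e := ⟨e.1, (N e.1).src e.2⟩
  tgt e := ⟨e.1, (N e.1).tgt e.2⟩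
  origin x := ⟨x.1, (N x.1).origin x.2⟩
  demands v := {x | ∃ m ∈ (N v.1).demands v.2, x = ⟨v.1, m⟩}
  acyclic := by
    rintro ⟨i, v⟩ h
    have key : ∀ q : Σ i, (N i).V, Relation.TransGen (fun a b => ∃ e : Σ i, (N i).E,
        (⟨e.1, (N e.1).src e.2⟩ : Σ i, (N i).V) = a ∧ ⟨e.1, (N e.1).tgt e.2⟩ = b) ⟨i, v⟩ q →
        ∃ w, q = ⟨i, w⟩ ∧
          Relation.TransGen (fun a b => ∃ e, (N i).src e = a ∧ (N i).tgt e = b) v w := by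
      intro q hq
      induction hq with
      | single h =>
        obtain ⟨⟨j, e⟩, h1, rfl⟩ := h
        obtain ⟨rfl, h1⟩ := Sigma.mk.inj_iff.1 h1
        exact ⟨_, rfl, .single ⟨e, eq_of_heq h1, rfl⟩⟩
      | tail _ h ih =>
        obtain ⟨w, rfl, hw⟩ := ih
        obtain ⟨⟨j, e⟩, h1, rfl⟩ := h
        obtain ⟨rfl, h1⟩ := Sigma.mk.inj_iff.1 h1
        exact ⟨_, rfl, hw.tail ⟨e, eq_of_heq h1, rfl⟩⟩
    obtain ⟨w, hw, hv⟩ := key _ h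
    obtain rfl := eq_of_heq (Sigma.mk.inj_iff.1 hw).2
    exact (N i).acyclic _ hv

end Network

/-! ## Networks built from blocks

The building block `B(s)` has inputs `y_0, …, y_s`, nodes `u_i`, `v_i`, `R_i` for `0 ≤ i ≤ s`, and
nodes `u`, `v`.  The node `u_i` receives every input except `y_i` and has one out-edge, to `v_i`.
The node `u` receives every input and has one out-edge, to `v`.  The receiver `R_i` has an in-edge
from `v_i` and an in-edge from `v`, and demands `y_i`.  The `i`-th output edge of the block leaves
the node `v_i`. -/

/-- The nodes of a network consisting of one source for every message in `Msg`, blocks `B(s l)`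
for `l : ι`, and one additional receiver. -/
inductive BlockNode (ι : Type) (s : ι → ℕ) (Msg : Type) : Type
  | source (x : Msg)
  | u (l : ι) (i : Fin (s l + 1))
  | uAll (l : ι)
  | v (l : ι) (i : Fin (s l + 1))
  | vAll (l : ι)
  | recv (l : ι) (i : Fin (s l + 1))
  | recvExtra

/-- The edges of such a network, where `out l i` says that the `i`-th output edge of the block `l`
is connected to the additional receiver. -/
inductive BlockEdge (ι : Type) (s : ι → ℕ) (out : (l : ι) → Fin (s l + 1) → Prop) : Type
  /-- from the source of the `j`-th input to `u_i`, for `j ≠ i` -/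
  | inputU (l : ι) (i j : Fin (s l + 1)) (h : j ≠ i)
  /-- from the source of the `j`-th input to `u` -/
  | inputUAll (l : ι) (j : Fin (s l + 1))
  /-- from `u_i` to `v_i` -/
  | uv (l : ι) (i : Fin (s l + 1))
  /-- from `u` to `v` -/
  | uvAll (l : ι)
  /-- from `v_i` to `R_i` -/
  | vRecv (l : ι) (i : Fin (s l + 1))
  /-- from `v` to `R_i` -/
  | vAllRecv (l : ι) (i : Fin (s l + 1))
  /-- the `i`-th output edge, from `v_i` to the additional receiver -/
  | output (l : ι) (i : Fin (s l + 1)) (h : out l i)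

/-- The node at which an edge starts, if `inp l i` is the message which is the `i`-th input of the
block `l`. -/
def BlockEdge.src {ι : Type} {s : ι → ℕ} {out : (l : ι) → Fin (s l + 1) → Prop} {Msg : Type}
    (inp : (l : ι) → Fin (s l + 1) → Msg) : BlockEdge ι s out → BlockNode ι s Msg
  | .inputU l _ j _ => .source (inp l j)
  | .inputUAll l j => .source (inp l j)
  | .uv l i => .u l i
  | .uvAll l => .uAll l
  | .vRecv l i => .v l i
  | .vAllRecv l _ => .vAll l
  | .output l i _ => .v l i

/-- The node at which an edge ends. -/
def BlockEdge.tgt {ι : Type} {s : ι → ℕ} {out : (l : ι) → Fin (s l + 1) → Prop} (Msg : Type) :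
    BlockEdge ι s out → BlockNode ι s Msg
  | .inputU l i _ _ => .u l i
  | .inputUAll l _ => .uAll l
  | .uv l i => .v l i
  | .uvAll l => .vAll l
  | .vRecv l i => .recv l i
  | .vAllRecv l i => .recv l i
  | .output _ _ _ => .recvExtra

/-- The layer of a node, used only to see that there are no directed cycles. -/
def BlockNode.level {ι : Type} {s : ι → ℕ} {Msg : Type} : BlockNode ι s Msg → ℕ
  | .source _ => 0
  | .u _ _ => 1
  | .uAll _ => 1
  | .v _ _ => 2
  | .vAll _ => 2
  | .recv _ _ => 3
  | .recvExtra => 3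

theorem BlockEdge.level_lt {ι : Type} {s : ι → ℕ} {out : (l : ι) → Fin (s l + 1) → Prop}
    {Msg : Type} (inp : (l : ι) → Fin (s l + 1) → Msg) (e : BlockEdge ι s out) :
    (e.src inp).level < (e.tgt Msg).level := by
  cases e <;> simp [BlockEdge.src, BlockEdge.tgt, BlockNode.level]

theorem BlockNode.finite (ι : Type) [Finite ι] (s : ι → ℕ) (Msg : Type) [Finite Msg] :
    Finite (BlockNode ι s Msg) := by
  let P := Σ l, Fin (s l + 1)
  let f : Msg ⊕ P ⊕ ι ⊕ P ⊕ ι ⊕ P ⊕ Unit → BlockNode ι s Msg :=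
    Sum.elim .source <| Sum.elim (fun p => .u p.1 p.2) <| Sum.elim .uAll <|
      Sum.elim (fun p => .v p.1 p.2) <| Sum.elim .vAll <|
      Sum.elim (fun p => .recv p.1 p.2) fun _ => .recvExtra
  refine Finite.of_surjective f fun b => ?_
  cases b with
  | source x => exact ⟨.inl x, rfl⟩
  | u l i => exact ⟨.inr (.inl ⟨l, i⟩), rfl⟩
  | uAll l => exact ⟨.inr (.inr (.inl l)), rfl⟩
  | v l i => exact ⟨.inr (.inr (.inr (.inl ⟨l, i⟩))), rfl⟩
  | vAll l => exact ⟨.inr (.inr (.inr (.inr (.inl l)))), rfl⟩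
  | recv l i => exact ⟨.inr (.inr (.inr (.inr (.inr (.inl ⟨l, i⟩))))), rfl⟩
  | recvExtra => exact ⟨.inr (.inr (.inr (.inr (.inr (.inr ()))))), rfl⟩

theorem BlockEdge.finite (ι : Type) [Finite ι] (s : ι → ℕ)
    (out : (l : ι) → Fin (s l + 1) → Prop) : Finite (BlockEdge ι s out) := by
  let P := Σ l, Fin (s l + 1)
  let P2 := Σ l, {p : Fin (s l + 1) × Fin (s l + 1) // p.2 ≠ p.1}
  let O := Σ l, {i : Fin (s l + 1) // out l i}
  let f : P2 ⊕ P ⊕ P ⊕ ι ⊕ P ⊕ P ⊕ O → BlockEdge ι s out :=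
    Sum.elim (fun p => .inputU p.1 p.2.1.1 p.2.1.2 p.2.2) <|
      Sum.elim (fun p => .inputUAll p.1 p.2) <| Sum.elim (fun p => .uv p.1 p.2) <|
      Sum.elim .uvAll <| Sum.elim (fun p => .vRecv p.1 p.2) <|
      Sum.elim (fun p => .vAllRecv p.1 p.2) fun p => .output p.1 p.2.1 p.2.2
  refine Finite.of_surjective f fun b => ?_
  cases b with
  | inputU l i j h => exact ⟨.inl ⟨l, ⟨(i, j), h⟩⟩, rfl⟩
  | inputUAll l j => exact ⟨.inr (.inl ⟨l, j⟩), rfl⟩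
  | uv l i => exact ⟨.inr (.inr (.inl ⟨l, i⟩)), rfl⟩
  | uvAll l => exact ⟨.inr (.inr (.inr (.inl l))), rfl⟩
  | vRecv l i => exact ⟨.inr (.inr (.inr (.inr (.inl ⟨l, i⟩)))), rfl⟩
  | vAllRecv l i => exact ⟨.inr (.inr (.inr (.inr (.inr (.inl ⟨l, i⟩))))), rfl⟩
  | output l i h => exact ⟨.inr (.inr (.inr (.inr (.inr (.inr ⟨l, ⟨i, h⟩⟩))))), rfl⟩

namespace Network

/-- The network with one source for every message in `Msg`, blocks `B(s l)` for `l : ι` whose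
`i`-th input is the message `inp l i`, and one additional receiver, which demands the message `z`
and is connected to the `i`-th output edge of the block `l` if `out l i` holds; the other output
edges are unused. -/
noncomputable def ofBlocks (ι : Type) [Fintype ι] (s : ι → ℕ) (Msg : Type) [Fintype Msg]
    (inp : (l : ι) → Fin (s l + 1) → Msg) (out : (l : ι) → Fin (s l + 1) → Prop) (z : Msg) :
    Network where
  V := BlockNode ι s Msg
  E := BlockEdge ι s out
  M := Msg
  fintypeV := @Fintype.ofFinite _ (BlockNode.finite ι s Msg)
  fintypeE := @Fintype.ofFinite _ (BlockEdge.finite ι s out)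
  fintypeM := inferInstance
  src e := e.src inp
  tgt e := e.tgt Msg
  origin x := .source x
  demands
    | .recv l i => {inp l i}
    | .recvExtra => {z}
    | _ => ∅
  acyclic := by
    intro v h
    have key : ∀ w, Relation.TransGen (fun a b => ∃ e : BlockEdge ι s out,
        e.src inp = a ∧ e.tgt Msg = b) v w → v.level < w.level := by
      intro w hw
      induction hw with
      | single h =>
        obtain ⟨e, rfl, rfl⟩ := h
        exact e.level_lt inp
      | tail _ h ih =>
        obtain ⟨e, rfl, rfl⟩ := h
        exact ih.trans (e.level_lt inp)
    exact lt_irrefl _ (key v h)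

/-- The network `N₁(m)`: one block `B(m)` with inputs `x_0, …, x_m`, and a receiver which receives
all of the output edges and demands `x_0`. -/
noncomputable def N1 (m : ℕ) : Network :=
  ofBlocks Unit (fun _ => m) (Fin (m + 1)) (fun _ i => i) (fun _ _ => True) 0

/-- The network `N₂(m, w)`: `w` blocks `B(m + 1)`.  The `0`-th input of every block is the shared
message `z` (here `none`), the other inputs of the `l`-th block are its own messages
`x_1, …, x_{m + 1}`.  An additional receiver receives all of the output edges except the `0`-th one
of every block and demands `z`. -/
noncomputable def N2 (m w : ℕ) : Network :=
  ofBlocks (Fin w) (fun _ => m + 1) (Option (Fin w × Fin (m + 1)))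
    (fun l => Fin.cases none fun j => some (l, j)) (fun _ i => i ≠ 0) none

/-- The network `N₃(m₁, m₂)`: a block `B(m₁)` and a block `B(m₂)`.  The `0`-th input of both blocks
is the shared message `z` (here `none`), the other inputs of each block are its own messages.
An additional receiver receives all of the output edges of both blocks and demands `z`. -/
noncomputable def N3 (m₁ m₂ : ℕ) : Network :=
  ofBlocks (Fin 2) ![m₁, m₂] (Option (Σ l : Fin 2, Fin (![m₁, m₂] l)))
    (fun l => Fin.cases none fun j => some ⟨l, j⟩) (fun _ _ => True) none

/-! ## The network `N₄(m)` -/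

/-- `f(m) = ∏ p^(γ - 1)`, over the prime powers `p^γ` in the factorization of `m`. -/
def fN4 (m : ℕ) : ℕ := ∏ p ∈ m.primeFactors, p ^ (m.factorization p - 1)

/-- `μ(m, p) = min {α ≥ 0 : p^α ≥ f(m)}`. -/
noncomputable def muN4 (m p : ℕ) : ℕ := sInf {α : ℕ | fN4 m ≤ p ^ α}

/-- `g(m, p) = p^(γ - 1) ∏ q^μ(m, q)`, where `γ` is the exponent of `p` in `m` and the product is
over the prime divisors `q ≠ p` of `m`. -/
noncomputable def gN4 (m p : ℕ) : ℕ :=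
  p ^ (m.factorization p - 1) * ∏ q ∈ m.primeFactors.erase p, q ^ muN4 m q

/-- The network `N₄(m)`: the disjoint union of the networks `N₁(q)` for the primes `q < f(m)` which
do not divide `m`, the networks `N₂(p^γ, m / p^γ)` for the prime powers `p^γ` in the factorization
of `m`, and the networks `N₃(p, g(m, p))` for those with `γ > 1`. -/
noncomputable def N4 (m : ℕ) : Network :=
  disjointUnion (ι :=
      {q // q ∈ (Finset.range (fN4 m)).filter fun q => q.Prime ∧ ¬ q ∣ m} ⊕
      {p // p ∈ m.primeFactors} ⊕
      {p // p ∈ m.primeFactors.filter fun p => 1 < m.factorization p})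
    (Sum.elim (fun q => N1 q.1) <|
      Sum.elim (fun p => N2 (p.1 ^ m.factorization p.1) (m / p.1 ^ m.factorization p.1))
        fun p => N3 p.1 (gN4 m p.1))

end Network

/-!
If some prime `q ∣ m` is nonzero in `F`, the component `N₂(q ^ γ, m / q ^ γ)` of `N₄(m)` already has
no linear solutions of rate close to `1`.  Otherwise all primes dividing `m` vanish in `F`, so `m`
is a power of a single prime `p`; as `m` is composite, the exponent is at least `2`, so that both
`p` and `g(m, p)`, which is divisible by `p`, vanish in `F`, and the component `N₃(p, g(m, p))` has
no such solutions.  The components `N₁` are not used.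

Both cases rest on one observation about blocks which share their `0`-th input `z`.  In a linear
solution write `∑ j, B j (y j)` for the vector on `u → v` and `e i` for the one on `u i → v i`, which
does not involve `y i`, and let `R i` decode by `y i = D i (e i) + D' i (∑ j, B j (y j))`.  Comparing
coefficients, `D' i ∘ B i = 1` and `D i (e i) = - D' i (∑ j ≠ i, B j (y j))`.  If `k = n`, then the
`B j` and `D i` are invertible, and giving `B j (y j)` the value `c j • B 0 z`, with scalars `c j`
such that `c 0 = 1` and `∑ j ≠ i, c j = 0` for every used output `i`, makes all used outputs vanish
without determining `z`.  Such scalars are `c j = 1` when the block sizes vanish in `F` (for `N₃`),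
and `c j = - 1 / m` for `j ≠ 0` when `m` does not vanish in `F` and the `0`-th output is unused
(for `N₂`).  For `k < n` the maps `B j ∘ D' j - 1` have rank at most `n - k` and the kernels of the
`D i` have dimension at most `2 (n - k)`, so the same choice makes all used outputs vanish for `z` in
a subspace of codimension at most `3 P (n - k)`, where `P` is the number of inputs of the blocks
(`finrank_le_of_block_equations`).  As the used outputs determine `z`, this subspace is zero and
`k ≤ 3 P (n - k)`, which bounds `k / n` away from `1`
(`Network.not_asymptoticallyLinearSolvable_ofBlocks`).
-/

/-! ### Dimension counting -/

open Module in
/-- The common kernel of finitely many linear maps, each with image in a subspace of dimension at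
most `r`, has codimension at most `r` times the number of maps. -/
theorem finrank_le_card_mul_add_finrank_iInf_ker {F V U P : Type*} [Field F] [AddCommGroup V]
    [Module F V] [FiniteDimensional F V] [AddCommGroup U] [Module F U] [FiniteDimensional F U]
    [Fintype P] (T : P → V →ₗ[F] U) (S : P → Submodule F U) (hT : ∀ p v, T p v ∈ S p)
    (r : ℕ) (hS : ∀ p, finrank F (S p) ≤ r) :
    finrank F V ≤ Fintype.card P * r + finrank F (⨅ p, LinearMap.ker (T p) : Submodule F V) := by
  let φ : V →ₗ[F] ((p : P) → S p) := LinearMap.pi fun p => (T p).codRestrict (S p) (hT p)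
  have hker : LinearMap.ker φ = ⨅ p, LinearMap.ker (T p) := by
    simp [φ, LinearMap.ker_pi, LinearMap.ker_codRestrict]
  have h1 := LinearMap.finrank_range_add_finrank_ker φ
  have h2 : finrank F (LinearMap.range φ) ≤ Fintype.card P * r := by
    refine (Submodule.finrank_le _).trans ?_
    rw [finrank_pi_fintype]
    exact (Finset.sum_le_card_nsmul _ _ r fun p _ => hS p).trans_eq (by simp)
  rw [hker] at h1
  omega

open Module in
/-- The map `B ∘ D - 1` vanishes on the image of `B`. -/
theorem finrank_range_comp_sub_id_le {F V U : Type*} [Field F] [AddCommGroup V]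
    [Module F V] [FiniteDimensional F V] [AddCommGroup U] [Module F U] [FiniteDimensional F U]
    (B : V →ₗ[F] U) (D : U →ₗ[F] V) (h : ∀ v, D (B v) = v) :
    finrank F (LinearMap.range (B ∘ₗ D - LinearMap.id)) ≤ finrank F U - finrank F V := by
  have h1 := LinearMap.finrank_range_add_finrank_ker (B ∘ₗ D - LinearMap.id)
  have h2 : LinearMap.range B ≤ LinearMap.ker (B ∘ₗ D - LinearMap.id) := by
    rintro _ ⟨v, rfl⟩
    simp [h]
  have h3 := Submodule.finrank_mono h2
  rw [LinearMap.finrank_range_of_inj (Function.LeftInverse.injective h)] at h3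
  omega

open Module in
/-- Since `D ∘ A = - D' ∘ B`, the rank of `D` is at least that of `D' ∘ B`. -/
theorem finrank_ker_le_two_mul {F V U : Type*} [Field F] [AddCommGroup V]
    [Module F V] [FiniteDimensional F V] [AddCommGroup U] [Module F U] [FiniteDimensional F U]
    (A B : V →ₗ[F] U) (D D' : U →ₗ[F] V) (hB : Function.Injective B)
    (hD' : Function.Surjective D') (h : ∀ v, D (A v) + D' (B v) = 0) :
    finrank F (LinearMap.ker D) ≤ 2 * (finrank F U - finrank F V) := by
  have h1 := LinearMap.finrank_range_add_finrank_ker D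
  have h2 := LinearMap.finrank_range_add_finrank_ker D'
  have h3 := LinearMap.finrank_range_add_finrank_ker (D' ∘ₗ B)
  have h4 : LinearMap.range (D' ∘ₗ B) ≤ LinearMap.range D := by
    rintro _ ⟨v, rfl⟩
    exact ⟨-A v, by rw [map_neg, neg_eq_iff_eq_neg, eq_neg_iff_add_eq_zero]; exact h v⟩
  have h5 := Submodule.finrank_mono h4
  have h6 : finrank F (LinearMap.ker (D' ∘ₗ B)) ≤ finrank F (LinearMap.ker D') := by
    rw [(Submodule.equivMapOfInjective B hB _).finrank_eq]
    refine Submodule.finrank_mono ?_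
    rintro _ ⟨v, hv, rfl⟩
    exact hv
  rw [LinearMap.range_eq_top.2 hD', finrank_top] at h2
  omega

/-- Let a family of blocks share their `0`-th input `ζ`.  In the block `l`, the edge `u_i → v_i`
carries `∑_{j ≠ i} A l i j (w l j)`, the edge `u → v` carries `∑ j, B l j (w l j)`, and the
receiver `R_i` decodes by `D l i` and `D' l i`.  If scalars `c l j` with `c l 0 = 1` satisfy
`∑_{j ≠ i} c l j = 0` for all used outputs, and the used outputs determine `ζ`, then the excess
`n - k` of the edge capacity is bounded below by a fixed multiple of `k`. -/
theorem finrank_le_of_block_equations {F V U ι : Type*} [Field F] [AddCommGroup V]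
    [Module F V] [FiniteDimensional F V] [AddCommGroup U] [Module F U] [FiniteDimensional F U]
    [Fintype ι] (s : ι → ℕ) (hs : ∀ l, s l ≠ 0) (out : (l : ι) → Fin (s l + 1) → Prop)
    (A : (l : ι) → Fin (s l + 1) → Fin (s l + 1) → V →ₗ[F] U)
    (B : (l : ι) → Fin (s l + 1) → V →ₗ[F] U)
    (D D' : (l : ι) → Fin (s l + 1) → U →ₗ[F] V)
    (hdec : ∀ l (w : Fin (s l + 1) → V) i,
      D l i (∑ j ∈ Finset.univ.erase i, A l i j (w j)) + D' l i (∑ j, B l j (w j)) = w i)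
    (hz : ∀ (w : (l : ι) → Fin (s l + 1) → V) (ζ : V), (∀ l, w l 0 = ζ) →
      (∀ l i, out l i → ∑ j ∈ Finset.univ.erase i, A l i j (w l j) = 0) → ζ = 0)
    (c : (l : ι) → Fin (s l + 1) → F) (hc0 : ∀ l, c l 0 = 1)
    (hc : ∀ l i, out l i → ∑ j ∈ Finset.univ.erase i, c l j = 0) :
    Module.finrank F V ≤
      3 * Fintype.card (Σ l, Fin (s l + 1)) * (Module.finrank F U - Module.finrank F V) := by
  classical
  set d := Module.finrank F U - Module.finrank F V with hd
  have hDB : ∀ l i v, D' l i (B l i v) = v := by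
    intro l i v
    have h := hdec l (Pi.single i v) i
    rw [Finset.sum_eq_zero (fun j hj => by
        rw [Pi.single_eq_of_ne (Finset.ne_of_mem_erase hj), map_zero]), map_zero, zero_add,
      Finset.sum_eq_single i (fun j _ hj => by rw [Pi.single_eq_of_ne hj, map_zero]) (by simp),
      Pi.single_eq_same] at h
    exact h
  have hDA : ∀ l i j, j ≠ i → ∀ v, D l i (A l i j v) + D' l i (B l j v) = 0 := by
    intro l i j hji v
    have h := hdec l (Pi.single j v) i
    rw [Finset.sum_eq_single j (fun j' _ hj => by rw [Pi.single_eq_of_ne hj, map_zero])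
        (by simp [hji]),
      Finset.sum_eq_single j (fun j' _ hj => by rw [Pi.single_eq_of_ne hj, map_zero]) (by simp),
      Pi.single_eq_same, Pi.single_eq_of_ne hji.symm] at h
    exact h
  -- `T p` measures by how much `B j (D' j (B 0 ζ))` misses `B 0 ζ`
  let T : (Σ l, Fin (s l + 1)) → V →ₗ[F] U := fun p =>
    (B p.1 p.2 ∘ₗ D' p.1 p.2 - LinearMap.id) ∘ₗ B p.1 0
  -- `E p` is the vector on a used output if the inputs are `w j = c j • D' j (B 0 ζ)`
  let E : {p : Σ l, Fin (s l + 1) // out p.1 p.2} → V →ₗ[F] U := fun p =>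
    ∑ j ∈ Finset.univ.erase p.1.2, c p.1.1 j • A p.1.1 p.1.2 j ∘ₗ D' p.1.1 j ∘ₗ B p.1.1 0
  have h1 := finrank_le_card_mul_add_finrank_iInf_ker T
    (fun p => LinearMap.range (B p.1 p.2 ∘ₗ D' p.1 p.2 - LinearMap.id))
    (fun p v => LinearMap.mem_range_self _ _) d
    (fun p => finrank_range_comp_sub_id_le _ _ (hDB p.1 p.2))
  have hK : ∀ v ∈ (⨅ p, LinearMap.ker (T p)), ∀ l j,
      B l j (D' l j (B l 0 v)) = B l 0 v := by
    intro v hv l j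
    have := (Submodule.mem_iInf _).1 hv ⟨l, j⟩
    simpa [T, sub_eq_zero] using this
  have h2 := finrank_le_card_mul_add_finrank_iInf_ker
    (fun p => E p ∘ₗ (⨅ p, LinearMap.ker (T p)).subtype) (fun p => LinearMap.ker (D p.1.1 p.1.2))
    (by
      rintro ⟨⟨l, i⟩, ho⟩ ⟨v, hv⟩
      have h := hdec l (fun j => c l j • D' l j (B l 0 v)) i
      simp only [map_smul, hK v hv] at h
      rw [← Finset.sum_smul, ← Finset.add_sum_erase _ _ (Finset.mem_univ i), hc l i ho, add_zero,
        map_smul, add_eq_right] at h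
      simpa [E] using h)
    (2 * d)
    (by
      rintro ⟨⟨l, i⟩, ho⟩
      have : Nontrivial (Fin (s l + 1)) := Fin.nontrivial_iff_two_le.2 (by have := hs l; omega)
      obtain ⟨j, hj⟩ := exists_ne i
      exact finrank_ker_le_two_mul (A l i j) (B l j) _ (D' l i)
        (Function.LeftInverse.injective (hDB l j))
        (Function.RightInverse.surjective (hDB l i)) (hDA l i j hj))
  have h3 : (⨅ p, LinearMap.ker (E p ∘ₗ (⨅ p, LinearMap.ker (T p)).subtype)) = ⊥ := by
    rw [eq_bot_iff]
    rintro ⟨v, hv⟩ hv'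
    have : v = 0 := by
      refine hz (fun l j => c l j • D' l j (B l 0 v)) v (fun l => by simp [hc0, hDB]) ?_
      intro l i ho
      have := (Submodule.mem_iInf _).1 hv' ⟨⟨l, i⟩, ho⟩
      simpa [E] using this
    simpa using this
  rw [h3, finrank_bot, add_zero] at h2
  have h4 := Fintype.card_subtype_le fun p : Σ l, Fin (s l + 1) => out p.1 p.2
  have h5 := Nat.mul_le_mul_right (2 * d) h4
  nlinarith

/-! ### Linear solutions of networks built from blocks -/

theorem LinearMap.apply_eq_sum_single {F V U J : Type*} [Field F] [AddCommGroup V] [Module F V]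
    [AddCommGroup U] [Module F U] [Fintype J] [DecidableEq J] (L : (J → V) →ₗ[F] U) (w : J → V) :
    L w = ∑ j, (L ∘ₗ LinearMap.single F (fun _ => V) j) (w j) := by
  simp only [LinearMap.comp_apply, LinearMap.single_apply, ← map_sum, Finset.univ_sum_single]

namespace Network

theorem NodeFn.IsLinear.exists_linearMap {N : Network} {F : Type*} [Field F] {k n : ℕ} {v : N.V}
    {r : ℕ} {f : N.NodeFn F k n v r} (hf : f.IsLinear) :
    ∃ G : ((N.MsgAt v → Fin k → F) × (N.InEdge v → Fin n → F)) →ₗ[F] (Fin r → F),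
      ∀ a b, f a b = G (a, b) := by
  classical
  obtain ⟨P, Q, h⟩ := hf
  refine ⟨(∑ i, (P i).mulVecLin ∘ₗ LinearMap.proj i) ∘ₗ LinearMap.fst F _ _ +
    (∑ j, (Q j).mulVecLin ∘ₗ LinearMap.proj j) ∘ₗ LinearMap.snd F _ _, fun a b => ?_⟩
  simp [h]

variable {F : Type*} [Field F] {k n : ℕ}

/-- A linear function at a node depends linearly on any tuple of parameters on which all inputs
of the node depend linearly. -/
theorem NodeFn.IsLinear.exists_linearMap_comp {N : Network} {v : N.V} {r : ℕ}
    {f : N.NodeFn F k n v r} (hf : f.IsLinear) {X W : Type*} [AddCommGroup W] [Module F W]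
    (w : X → W) (a : X → N.MsgAt v → Fin k → F) (b : X → N.InEdge v → Fin n → F)
    (ha : ∀ i, ∃ L : W →ₗ[F] (Fin k → F), ∀ x, a x i = L (w x))
    (hb : ∀ j, ∃ L : W →ₗ[F] (Fin n → F), ∀ x, b x j = L (w x)) :
    ∃ L : W →ₗ[F] (Fin r → F), ∀ x, f (a x) (b x) = L (w x) := by
  obtain ⟨G, hG⟩ := hf.exists_linearMap
  choose La hLa using ha
  choose Lb hLb using hb
  refine ⟨G ∘ₗ (LinearMap.pi La).prod (LinearMap.pi Lb), fun x => ?_⟩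
  rw [hG, LinearMap.comp_apply]
  congr 2
  · exact funext fun i => hLa i x
  · exact funext fun j => hLb j x

/-- The equations satisfied by a linear solution of a network built from blocks: the matrices
`A l i j` describe the edges `u_i → v_i`, the matrices `B l j` the edge `u → v`, and `D`, `D'` the
decoding at the receivers `R_i`. -/
theorem HasLinearSolution.exists_block_equations {ι : Type} [Fintype ι] {s : ι → ℕ} {Msg : Type}
    [Fintype Msg] {inp : (l : ι) → Fin (s l + 1) → Msg} {out : (l : ι) → Fin (s l + 1) → Prop}
    {z : Msg} (h : (ofBlocks ι s Msg inp out z).HasLinearSolution F k n) :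
    ∃ (A : (l : ι) → Fin (s l + 1) → Fin (s l + 1) → (Fin k → F) →ₗ[F] (Fin n → F))
      (B : (l : ι) → Fin (s l + 1) → (Fin k → F) →ₗ[F] (Fin n → F))
      (D D' : (l : ι) → Fin (s l + 1) → (Fin n → F) →ₗ[F] (Fin k → F)),
      (∀ (x : Msg → Fin k → F) l i,
        D l i (∑ j ∈ Finset.univ.erase i, A l i j (x (inp l j))) +
          D' l i (∑ j, B l j (x (inp l j))) = x (inp l i)) ∧
      ∀ x : Msg → Fin k → F,
        (∀ l i, out l i → ∑ j ∈ Finset.univ.erase i, A l i j (x (inp l j)) = 0) → x z = 0 := by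
  classical
  obtain ⟨C, ⟨hE, hD⟩, hS⟩ := h
  choose y hy hdec using hS
  have hmsg : ∀ v : (ofBlocks ι s Msg inp out z).V, (∀ m, v ≠ BlockNode.source m) →
      IsEmpty ((ofBlocks ι s Msg inp out z).MsgAt v) := fun v hv => ⟨fun m => hv m.1 m.2.symm⟩
  -- an edge leaving a source carries a linear function of the message of that source
  have hsrc : ∀ (e : BlockEdge ι s out) (m : Msg), e.src inp = .source m →
      ∃ L : (Fin k → F) →ₗ[F] (Fin n → F), ∀ x, y x e = L (x m) := by
    intro e m he
    obtain ⟨L, hL⟩ := (hE e).exists_linearMap_comp (fun x : Msg → Fin k → F => x m)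
      (fun x i => x i.1) (fun x j => y x j.1)
      (by
        rintro ⟨m', hm'⟩
        obtain rfl : m' = m := by
          have := hm'.trans he
          injection this
        exact ⟨LinearMap.id, fun x => rfl⟩)
      (by
        rintro ⟨d, hd⟩
        have := hd.trans he
        cases d <;> cases this)
    exact ⟨L, fun x => (hy x e).trans (hL x)⟩
  have huv : ∀ l i, ∃ L : ({j // j ∈ Finset.univ.erase i} → Fin k → F) →ₗ[F] (Fin n → F),
      ∀ x, y x (.uv l i) = L (fun j => x (inp l j.1)) := by
    intro l i
    obtain ⟨L, hL⟩ := (hE (.uv l i)).exists_linearMap_comp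
      (fun (x : Msg → Fin k → F) (j : {j // j ∈ Finset.univ.erase i}) => x (inp l j.1))
      (fun x i => x i.1) (fun x j => y x j.1)
      (fun m => ((hmsg (.u l i) (by rintro _ ⟨⟩)).false m).elim)
      (by
        rintro ⟨d, hd⟩
        change d.tgt Msg = .u l i at hd
        cases d <;> cases hd
        rename_i j hj
        obtain ⟨L, hL⟩ := hsrc (.inputU l i j hj) (inp l j) rfl
        exact ⟨L ∘ₗ LinearMap.proj (⟨j, by simpa using hj⟩ : {j // j ∈ Finset.univ.erase i}), hL⟩)
    exact ⟨L, fun x => (hy x _).trans (hL x)⟩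
  have huvAll : ∀ l, ∃ L : (Fin (s l + 1) → Fin k → F) →ₗ[F] (Fin n → F),
      ∀ x, y x (.uvAll l) = L (fun j => x (inp l j)) := by
    intro l
    obtain ⟨L, hL⟩ := (hE (.uvAll l)).exists_linearMap_comp
      (fun (x : Msg → Fin k → F) j => x (inp l j))
      (fun x i => x i.1) (fun x j => y x j.1)
      (fun m => ((hmsg (.uAll l) (by rintro _ ⟨⟩)).false m).elim)
      (by
        rintro ⟨d, hd⟩
        change d.tgt Msg = .uAll l at hd
        cases d <;> cases hd
        rename_i j
        obtain ⟨L, hL⟩ := hsrc (.inputUAll l j) (inp l j) rfl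
        exact ⟨L ∘ₗ LinearMap.proj j, hL⟩)
    exact ⟨L, fun x => (hy x _).trans (hL x)⟩
  have hv : ∀ (e : BlockEdge ι s out) l i, e.src inp = .v l i →
      ∃ L : (Fin n → F) →ₗ[F] (Fin n → F), ∀ x, y x e = L (y x (.uv l i)) := by
    intro e l i he
    obtain ⟨L, hL⟩ := (hE e).exists_linearMap_comp (fun x => y x (.uv l i))
      (fun x i => x i.1) (fun x j => y x j.1)
      (fun m => ((hmsg _ (by intro m hm; cases he.symm.trans hm)).false m).elim)
      (by
        rintro ⟨d, hd⟩
        have := hd.trans he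
        change d.tgt Msg = .v l i at this
        cases d <;> cases this
        exact ⟨LinearMap.id, fun x => rfl⟩)
    exact ⟨L, fun x => (hy x e).trans (hL x)⟩
  have hvAll : ∀ l i, ∃ L : (Fin n → F) →ₗ[F] (Fin n → F),
      ∀ x, y x (.vAllRecv l i) = L (y x (.uvAll l)) := by
    intro l i
    obtain ⟨L, hL⟩ := (hE (.vAllRecv l i)).exists_linearMap_comp (fun x => y x (.uvAll l))
      (fun x i => x i.1) (fun x j => y x j.1)
      (fun m => ((hmsg (.vAll l) (by rintro _ ⟨⟩)).false m).elim)
      (by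
        rintro ⟨d, hd⟩
        change d.tgt Msg = .vAll l at hd
        cases d <;> cases hd
        exact ⟨LinearMap.id, fun x => rfl⟩)
    exact ⟨L, fun x => (hy x _).trans (hL x)⟩
  have hrecv : ∀ l i, ∃ L : (Fin n → F) × (Fin n → F) →ₗ[F] (Fin k → F),
      ∀ x, x (inp l i) = L (y x (.uv l i), y x (.uvAll l)) := by
    intro l i
    obtain ⟨L, hL⟩ := (hD (.recv l i) (inp l i) rfl).exists_linearMap_comp
      (fun x => (y x (.uv l i), y x (.uvAll l))) (fun x i => x i.1) (fun x j => y x j.1)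
      (fun m => ((hmsg (.recv l i) (by rintro _ ⟨⟩)).false m).elim)
      (by
        rintro ⟨d, hd⟩
        change d.tgt Msg = .recv l i at hd
        cases d <;> cases hd
        · obtain ⟨L, hL⟩ := hv (.vRecv l i) l i rfl
          exact ⟨L ∘ₗ LinearMap.fst F _ _, hL⟩
        · obtain ⟨L, hL⟩ := hvAll l i
          exact ⟨L ∘ₗ LinearMap.snd F _ _, hL⟩)
    exact ⟨L, fun x => (hdec x (.recv l i) (inp l i) rfl).symm.trans (hL x)⟩
  have huv' : ∀ l i, ∃ A : Fin (s l + 1) → (Fin k → F) →ₗ[F] (Fin n → F),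
      ∀ x, y x (.uv l i) = ∑ j ∈ Finset.univ.erase i, A j (x (inp l j)) := by
    intro l i
    obtain ⟨L, hL⟩ := huv l i
    let A : Fin (s l + 1) → (Fin k → F) →ₗ[F] (Fin n → F) := fun j =>
      if h : j ∈ Finset.univ.erase i then
        L ∘ₗ LinearMap.single F (fun _ => Fin k → F) ⟨j, h⟩ else 0
    have hA : ∀ j : {j // j ∈ Finset.univ.erase i},
        A j = L ∘ₗ LinearMap.single F (fun _ => Fin k → F) j := fun j => dif_pos j.2
    refine ⟨A, fun x => ?_⟩
    rw [hL, LinearMap.apply_eq_sum_single,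
      ← Finset.sum_coe_sort (Finset.univ.erase i) fun j => A j (x (inp l j))]
    exact Finset.sum_congr rfl fun j _ => by rw [hA]
  choose A hA using huv'
  choose B hB using huvAll
  choose D hD' using hrecv
  refine ⟨A, fun l j => B l ∘ₗ LinearMap.single F (fun _ => Fin k → F) j,
    fun l i => D l i ∘ₗ LinearMap.inl F _ _, fun l i => D l i ∘ₗ LinearMap.inr F _ _,
    fun x l i => ?_, fun x hx => ?_⟩
  · have hB' : y x (.uvAll l) =
        ∑ j, (B l ∘ₗ LinearMap.single F (fun _ => Fin k → F) j) (x (inp l j)) :=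
      (hB l x).trans (LinearMap.apply_eq_sum_single (B l) _)
    refine Eq.trans ?_ (hD' l i x).symm
    rw [← hA l i x, ← hB']
    rw [LinearMap.comp_apply, LinearMap.comp_apply, ← (D l i).map_add, LinearMap.inl_apply,
      LinearMap.inr_apply, Prod.mk_add_mk, add_zero, zero_add]
  · obtain ⟨L, hL⟩ := (hD .recvExtra z rfl).exists_linearMap_comp
      (fun (x : Msg → Fin k → F) (p : Σ l, {i : Fin (s l + 1) // out l i}) => y x (.uv p.1 p.2.1))
      (fun x i => x i.1) (fun x j => y x j.1)
      (fun m => ((hmsg .recvExtra (by rintro _ ⟨⟩)).false m).elim)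
      (by
        rintro ⟨d, hd⟩
        change d.tgt Msg = .recvExtra at hd
        cases d <;> cases hd
        rename_i l i ho
        obtain ⟨L, hL⟩ := hv (.output l i ho) l i rfl
        exact ⟨L ∘ₗ LinearMap.proj (⟨l, i, ho⟩ : Σ l, {i : Fin (s l + 1) // out l i}), hL⟩)
    rw [← hdec x .recvExtra z rfl, hL x]
    convert map_zero L
    rename_i p
    exact (hA _ _ _).trans <| hx _ _ p.2.2

end Network

/-! ### Restricting a code to a component of a disjoint union -/

namespace Network

theorem HasLinearSolution.of_disjointUnion {ι : Type} [Fintype ι] {N : ι → Network}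
    {F : Type*} [Field F] {k n : ℕ} (h : (disjointUnion N).HasLinearSolution F k n) (i : ι) :
    (N i).HasLinearSolution F k n := by
  classical
  obtain ⟨C, ⟨hE, hD⟩, hS⟩ := h
  have injM : Function.Injective fun m : (N i).M => (⟨i, m⟩ : Σ i, (N i).M) :=
    fun _ _ h => eq_of_heq (Sigma.mk.inj_iff.1 h).2
  have injE : Function.Injective fun e : (N i).E => (⟨i, e⟩ : Σ i, (N i).E) :=
    fun _ _ h => eq_of_heq (Sigma.mk.inj_iff.1 h).2
  let εM : (v : (N i).V) → (N i).MsgAt v ≃ (disjointUnion N).MsgAt ⟨i, v⟩ := fun v =>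
    Equiv.ofBijective (fun x => ⟨⟨i, x.1⟩, congrArg (Sigma.mk i) x.2⟩) (by
      constructor
      · rintro ⟨x, hx⟩ ⟨y, hy⟩ h
        exact Subtype.ext (injM (congrArg Subtype.val h))
      · rintro ⟨⟨j, x⟩, hx⟩
        obtain ⟨rfl, hx⟩ := Sigma.mk.inj_iff.1 hx
        exact ⟨⟨x, eq_of_heq hx⟩, rfl⟩)
  let εE : (v : (N i).V) → (N i).InEdge v ≃ (disjointUnion N).InEdge ⟨i, v⟩ := fun v =>
    Equiv.ofBijective (fun x => ⟨⟨i, x.1⟩, congrArg (Sigma.mk i) x.2⟩) (by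
      constructor
      · rintro ⟨x, hx⟩ ⟨y, hy⟩ h
        exact Subtype.ext (injE (congrArg Subtype.val h))
      · rintro ⟨⟨j, x⟩, hx⟩
        obtain ⟨rfl, hx⟩ := Sigma.mk.inj_iff.1 hx
        exact ⟨⟨x, eq_of_heq hx⟩, rfl⟩)
  have hlin : ∀ (v : (N i).V) (r : ℕ) (f : (disjointUnion N).NodeFn F k n ⟨i, v⟩ r),
      f.IsLinear → NodeFn.IsLinear (N := N i) (v := v)
        (fun a b => f (fun x => a ((εM v).symm x)) fun x => b ((εE v).symm x)) := by
    rintro v r f ⟨P, Q, hPQ⟩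
    refine ⟨fun x => P (εM v x), fun x => Q (εE v x), fun a b => ?_⟩
    refine (hPQ _ _).trans ?_
    congr 1
    · refine ((εM v).sum_comp _).symm.trans (Finset.sum_congr rfl fun x _ => ?_)
      rw [Equiv.symm_apply_apply]
    · refine ((εE v).sum_comp _).symm.trans (Finset.sum_congr rfl fun x _ => ?_)
      rw [Equiv.symm_apply_apply]
  have hres : ∀ (x : (N i).M → Fin k → F) (x' : (disjointUnion N).M → Fin k → F),
      (∀ m, x' ⟨i, m⟩ = x m) → ∀ (y' : (disjointUnion N).E → Fin n → F) (v : (N i).V) (r : ℕ)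
      (f : (disjointUnion N).NodeFn F k n ⟨i, v⟩ r),
      f (fun m => x ((εM v).symm m).1) (fun e => y' ⟨i, ((εE v).symm e).1⟩) =
        f (fun m => x' m.1) (fun e => y' e.1) := by
    intro x x' hx y' v r f
    congr 1
    · funext m
      obtain ⟨m, rfl⟩ := (εM v).surjective m
      rw [Equiv.symm_apply_apply]
      exact (hx m.1).symm
    · funext e
      obtain ⟨e, rfl⟩ := (εE v).surjective e
      rw [Equiv.symm_apply_apply]
      rfl
  refine ⟨⟨fun e a b => C.edgeFn ⟨i, e⟩ (fun x => a ((εM _).symm x)) fun x => b ((εE _).symm x),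
    fun v m hm a b => C.decodeFn ⟨i, v⟩ ⟨i, m⟩ ⟨m, hm, rfl⟩ (fun x => a ((εM _).symm x))
      fun x => b ((εE _).symm x)⟩, ⟨fun e => hlin _ _ _ (hE ⟨i, e⟩),
    fun v m hm => hlin _ _ _ (hD ⟨i, v⟩ ⟨i, m⟩ ⟨m, hm, rfl⟩)⟩, fun x => ?_⟩
  let x' : (disjointUnion N).M → Fin k → F := 
    Function.extend (fun m : (N i).M => (⟨i, m⟩ : Σ i, (N i).M)) x 0
  have hx' : ∀ m, x' ⟨i, m⟩ = x m := fun m => injM.extend_apply x 0 m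
  obtain ⟨y', hy', hdec⟩ := hS x'
  refine ⟨fun e => y' ⟨i, e⟩, fun e => ?_, fun v m hm => ?_⟩
  · exact (hy' ⟨i, e⟩).trans (hres x x' hx' y' _ _ (C.edgeFn ⟨i, e⟩)).symm
  · rw [← hx' m, ← hdec ⟨i, v⟩ ⟨i, m⟩ ⟨m, hm, rfl⟩]
    exact hres x x' hx' y' _ _ _

theorem AsymptoticallyLinearSolvable.of_disjointUnion {ι : Type} [Fintype ι] {N : ι → Network}
    {F : Type*} [Field F] (h : (disjointUnion N).AsymptoticallyLinearSolvable F) (i : ι) :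
    (N i).AsymptoticallyLinearSolvable F := by
  intro ε hε
  obtain ⟨k, n, hk, hn, hkn, hsol⟩ := h ε hε
  exact ⟨k, n, hk, hn, hkn, hsol.of_disjointUnion i⟩

end Network

/-! ### The networks `N₂`, `N₃` and `N₄` -/

namespace Network

/-- Blocks sharing only their `0`-th input `z`, which is also the message demanded by the additional
receiver.  If scalars `c l j` with `c l 0 = 1` satisfy `∑_{j ≠ i} c l j = 0` for all used outputs,
then the rate of a linear solution is bounded away from `1`. -/
theorem not_asymptoticallyLinearSolvable_ofBlocks {F : Type*} [Field F] {ι : Type} [Fintype ι]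
    {s : ι → ℕ} (hs : ∀ l, s l ≠ 0) {Msg : Type} [Fintype Msg]
    {own : (l : ι) → Fin (s l) → Msg} {out : (l : ι) → Fin (s l + 1) → Prop} {z : Msg}
    (hown : Function.Injective fun p : Σ l, Fin (s l) => own p.1 p.2)
    (hz : ∀ l j, own l j ≠ z) (c : (l : ι) → Fin (s l + 1) → F) (hc0 : ∀ l, c l 0 = 1)
    (hc : ∀ l i, out l i → ∑ j ∈ Finset.univ.erase i, c l j = 0) :
    ¬ (ofBlocks ι s Msg (fun l => Fin.cases z (own l)) out z).AsymptoticallyLinearSolvable F := by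
  classical
  intro h
  set P := Fintype.card (Σ l, Fin (s l + 1)) with hP
  obtain ⟨k, n, hk, hn, hkn, hsol⟩ := h (1 / (3 * P + 1)) (by positivity)
  obtain ⟨A, B, D, D', hdec, hext⟩ := hsol.exists_block_equations
  -- the inputs of all blocks can be prescribed, as long as the `0`-th ones agree
  have hmsg : ∀ (w : (l : ι) → Fin (s l + 1) → Fin k → F) (ζ : Fin k → F), (∀ l, w l 0 = ζ) →
      ∃ x : Msg → Fin k → F, x z = ζ ∧
        ∀ l j, x (Fin.cases z (own l) j : Msg) = w l j := by
    intro w ζ hw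
    let x : Msg → Fin k → F := Function.update
      (Function.extend (fun p : Σ l, Fin (s l) => own p.1 p.2) (fun p => w p.1 p.2.succ) 0) z ζ
    have hxz : x z = ζ := Function.update_self ..
    refine ⟨x, hxz, fun l j => ?_⟩
    induction j using Fin.cases with
    | zero => exact hxz.trans (hw l).symm
    | succ j =>
      exact (Function.update_of_ne (hz l j) _ _).trans (hown.extend_apply _ _ ⟨l, j⟩)
  have hbound := finrank_le_of_block_equations s hs out A B D D'
    (by
      intro l w i
      obtain ⟨x, -, hx⟩ := hmsg (Function.update (fun _ _ => w 0) l w) (w 0) (by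
        intro l'
        by_cases hl : l' = l
        · subst hl
          rw [Function.update_self]
        · rw [Function.update_of_ne hl])
      have := hdec x l i
      simpa only [hx, Function.update_self] using this)
    (by
      intro w ζ hw h0
      obtain ⟨x, hxz, hx⟩ := hmsg w ζ hw
      rw [← hxz]
      refine hext x fun l i ho => ?_
      simpa only [hx] using h0 l i ho)
    c hc0 hc
  rw [Module.finrank_fin_fun, Module.finrank_fin_fun, ← hP] at hbound
  -- the dimension bound says that `k / n ≤ 3 P / (3 P + 1)`
  have hlt : k < n := by
    by_contra hcon
    rw [Nat.sub_eq_zero_of_le (not_lt.1 hcon)] at hbound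
    omega
  obtain ⟨d, rfl⟩ := Nat.exists_eq_add_of_lt hlt
  have hb : (k : ℝ) ≤ 3 * P * (d + 1) := by
    have : k + d + 1 - k = d + 1 := by omega
    rw [this] at hbound
    exact_mod_cast hbound
  rw [gt_iff_lt, lt_div_iff₀ (by exact_mod_cast hn)] at hkn
  have h1 : (1 - 1 / (3 * P + 1 : ℝ)) = 3 * P / (3 * P + 1) := by
    field_simp
    ring
  rw [h1, div_mul_eq_mul_div, div_lt_iff₀ (by positivity)] at hkn
  push_cast at hkn
  nlinarith

/-- Give `z` the coefficient `1` and all other inputs the coefficient `-1 / m`. -/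
theorem not_asymptoticallyLinearSolvable_N2 {F : Type*} [Field F] {m : ℕ} (hm : (m : F) ≠ 0)
    (w : ℕ) : ¬ (N2 m w).AsymptoticallyLinearSolvable F := by
  refine not_asymptoticallyLinearSolvable_ofBlocks (fun _ => Nat.succ_ne_zero m)
    (own := fun l j => some (l, j)) ?_ (fun l j => Option.some_ne_none _)
    (fun _ => Fin.cases 1 fun _ => -(m : F)⁻¹) (fun _ => rfl) ?_
  · rintro ⟨l, j⟩ ⟨l', j'⟩ h
    simp only [Option.some.injEq, Prod.mk.injEq] at h
    obtain ⟨rfl, rfl⟩ := h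
    rfl
  · intro l i hi
    obtain ⟨i, rfl⟩ := Fin.exists_succ_eq.2 hi
    rw [← add_right_inj, Finset.add_sum_erase _ _ (Finset.mem_univ _), Fin.sum_univ_succ]
    simp only [Fin.cases_zero, Fin.cases_succ, Finset.sum_const, Finset.card_univ,
      Fintype.card_fin, nsmul_eq_mul]
    push_cast
    field_simp
    ring

/-- Give all inputs the coefficient `1`. -/
theorem not_asymptoticallyLinearSolvable_N3 {F : Type*} [Field F] {m₁ m₂ : ℕ} (h₁ : m₁ ≠ 0)
    (h₂ : m₂ ≠ 0) (hm₁ : (m₁ : F) = 0) (hm₂ : (m₂ : F) = 0) :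
    ¬ (N3 m₁ m₂).AsymptoticallyLinearSolvable F := by
  refine not_asymptoticallyLinearSolvable_ofBlocks (s := ![m₁, m₂])
    (fun l => by fin_cases l <;> assumption)
    (own := fun l j => some (⟨l, j⟩ : Σ l : Fin 2, Fin (![m₁, m₂] l)))
    (fun p q h => Option.some_injective _ h)
    (fun l j => Option.some_ne_none _)
    (fun _ _ => 1) (fun _ => rfl) ?_
  intro l i _
  rw [Finset.sum_const, Finset.card_erase_of_mem (Finset.mem_univ i), Finset.card_univ,
    Fintype.card_fin, Nat.add_sub_cancel, nsmul_one]
  fin_cases l <;> assumption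

theorem gN4_ne_zero (m p : ℕ) (hp : p ≠ 0) : gN4 m p ≠ 0 :=
  mul_ne_zero (pow_ne_zero _ hp) <| Finset.prod_ne_zero_iff.2 fun _ hq =>
    pow_ne_zero _ (Nat.prime_of_mem_primeFactors (Finset.mem_of_mem_erase hq)).ne_zero

end Network

theorem corollary5p8 (m : ℕ) (hm : 1 < m) (hcomp : ¬ m.Prime)
    (F : Type*) [Field F] [Finite F] :
    ¬ (Network.N4 m).AsymptoticallyLinearSolvable F := by
  intro h
  by_cases hq : ∃ q ∈ m.primeFactors, (q : F) ≠ 0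
  · obtain ⟨q, hq, hqF⟩ := hq
    refine Network.not_asymptoticallyLinearSolvable_N2 (m := q ^ m.factorization q) ?_ _
      (h.of_disjointUnion (.inr (.inl ⟨q, hq⟩)))
    rw [Nat.cast_pow]
    exact pow_ne_zero _ hqF
  push Not at hq
  obtain ⟨p, hp, hpm⟩ := Nat.exists_prime_and_dvd hm.ne'
  have hpF : (p : F) = 0 := hq p (Nat.mem_primeFactors.2 ⟨hp, hpm, by omega⟩)
  -- two distinct primes cannot both vanish in `F`, so `m` is a power of `p`
  have hpow : m = p ^ m.primeFactorsList.length := by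
    refine Nat.eq_prime_pow_of_unique_prime_dvd (by omega) fun {q} hqp hqm => ?_
    by_contra hne
    have hqF : (q : F) = 0 := hq q (Nat.mem_primeFactors.2 ⟨hqp, hqm, by omega⟩)
    have hcop : IsCoprime (q : ℤ) (p : ℤ) :=
      Nat.isCoprime_iff_coprime.2 ((Nat.coprime_primes hqp hp).2 hne)
    obtain ⟨a, b, hab⟩ := hcop
    have := congrArg (Int.cast : ℤ → F) hab
    simp [hqF, hpF] at this
  generalize m.primeFactorsList.length = γ at hpow
  have hfac : m.factorization p = γ := by rw [hpow, hp.factorization_pow, Finsupp.single_eq_same]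
  have hγ : 1 < γ := by
    rcases γ with _ | _ | γ
    · rw [pow_zero] at hpow
      omega
    · rw [zero_add, pow_one] at hpow
      exact absurd (hpow ▸ hp) hcomp
    · omega
  refine Network.not_asymptoticallyLinearSolvable_N3 (m₁ := p) hp.ne_zero
    (Network.gN4_ne_zero m p hp.ne_zero) hpF ?_ (h.of_disjointUnion (.inr (.inr ⟨p, ?_⟩)))
  · rw [Network.gN4, Nat.cast_mul, Nat.cast_pow, hpF, hfac, zero_pow (by omega), zero_mul]
  · exact Finset.mem_filter.2 ⟨Nat.mem_primeFactors.2 ⟨hp, hpm, by omega⟩, by omega⟩
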